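/- Write $\mathbb{N}=\{0,1,2,\dots\}$, $[k]_q=1+q+\cdots+q^{k-1}$ for $k\in\mathbb{N}$ (so $[0]_q=0$), and let $n\in\mathbb{N}$. For $\mathbf{x}=(x_1,\dots,x_n)\in\mathbb{N}^n$, let $\mathrm{PF}(\mathbf{x})$ be the set of $\mathbf{x}$-parking functions: the sequences $\alpha=(\alpha_1,\dots,\alpha_n)\in\mathbb{N}^n$ whose weakly increasing rearrangement $\alpha_{i_1}\le\cdots\le\alpha_{i_n}$ satisfies $\alpha_{i_j}\le\left(\sum_{k=1}^{j}x_k\right)-1$ for all $1\le j\le n$. For $\alpha\in\mathrm{PF}(\mathbf{x})$ put $\mathrm{rsum}(\alpha)=\left(\sum_{i=1}^{n}(n+1-i)x_i\right)-n-\sum_{i=1}^{n}\alpha_i$. A tree $T$ with vertex set $\{0,1,\dots,n\}$ is always rooted at $0$. Write $i\le_T j$ if the path in $T$ from $j$ to $0$ passes through $i$, write $\mathrm{par}_T(j)$ for the parent of a vertex $j\ne 0$, and let $\mathrm{outdeg}_T(i)$ be the number of children of $i$. Two non-root vertices are siblings if they have the same parent. Let $\mathrm{RPT}(n+1)$ be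 the set of rooted plane trees on $n+1$ vertices, labeled in depth-first order, that is, the set of trees $T$ with vertex set $\{0,\dots,n\}$ such that $i\le_T j$ implies $i\le j$ for all $1\le i,j\le n$, and $i\le_T k$ implies $i\le_T j$ for all $1\le i<j<k\le n$. For $T\in\mathrm{RPT}(n+1)$, let $\mathrm{AVO}(T)$ be the set of strict total orders $\prec$ on $\{1,\dots,n\}$ such that $j\prec i$ whenever $1\le i<j\le n$ are siblings. **Theorem.** For every $\mathbf{x}\in\mathbb{N}^n$, $$\sum_{\alpha\in\mathrm{PF}(\mathbf{x})}q^{\mathrm{rsum}(\alpha)}=\sum_{T\in\mathrm{RPT}(n+1)}\left(\sum_{\prec\,\in\mathrm{AVO}(T)}q^{\sum_{i\le_T j,\;j\prec i}x_{\mathrm{par}_T(i)+1}}\right)\left(\prod_{i=1}^{n}[x_i]_q^{\mathrm{outdeg}_T(i-1)}\right)$$ in $\mathbb{Z}[q,q^{-1}]$, where the sum in the exponent runs over pairs $(i,j)$ of non-root vertices. For $\mathbf{x}=(1,\dots,1)$ this recovers Kreweras's identity. That is, the left side equals $\sum_{\alpha\in\mathrm{PF}(n)}q^{\binom{n}{2}-\sum_i\alpha_i}$,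 where $\mathrm{PF}(n)$ is the set of $\alpha\in\mathbb{N}^n$ whose weakly increasing rearrangement satisfies $\alpha_{i_j}\le j-1$ for all $1\le j\le n$; the right side equals $\sum_{T}q^{\mathrm{inv}(T)}$, summed over all trees $T$ with vertex set $\{0,\dots,n\}$, where $\mathrm{inv}(T)$ is the number of pairs $1\le i<j\le n$ such that the path from $i$ to $0$ passes through $j$; and hence $$\sum_{\alpha\in\mathrm{PF}(n)}q^{\binom{n}{2}-\sum_i\alpha_i}=\sum_{T}q^{\mathrm{inv}(T)}.$$ -/

import Mathlib

/-!
Conventions. A vector `(x₁, …, xₙ) ∈ ℕⁿ` is a function `x : Fin n → ℕ`, with `xᵢ₊₁ = x i`.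
Trees have vertex set `{0, 1, …, n} = Fin (n + 1)` and root `0`. The non-root vertices
`1, …, n` are `i.succ` for `i : Fin n`. The power `q ^ k`, for an integer `k`, is the monomial
`LaurentPolynomial.T k` in the ring `ℤ[q, q⁻¹] = LaurentPolynomial ℤ`.
-/

namespace VectorParking

/-! ### Parking functions -/

/-- `α` is an `x`-parking function: its weakly increasing rearrangement
`α_{i₁} ≤ ⋯ ≤ α_{iₙ}` satisfies `α_{i_j} ≤ (x₁ + ⋯ + x_j) - 1` for all `1 ≤ j ≤ n`. -/
def IsVectorParkingFunction {n : ℕ} (x α : Fin n → ℕ) : Prop :=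
  ∀ j : Fin n, (α (Tuple.sort α j) : ℤ) ≤ (∑ k ∈ Finset.Iic j, (x k : ℤ)) - 1

theorem finite_setOf_isVectorParkingFunction {n : ℕ} (x : Fin n → ℕ) :
    {α : Fin n → ℕ | IsVectorParkingFunction x α}.Finite := by
  refine (Set.finite_Iic (fun _ : Fin n => ∑ k, x k)).subset ?_
  intro α hα i
  have h := hα ((Tuple.sort α).symm i)
  rw [Equiv.apply_symm_apply] at h
  have h2 : ∑ k ∈ Finset.Iic ((Tuple.sort α).symm i), (x k : ℤ) ≤ ∑ k, (x k : ℤ) :=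
    Finset.sum_le_sum_of_subset_of_nonneg (Finset.subset_univ _) (fun _ _ _ => by positivity)
  have h3 : (α i : ℤ) ≤ ((∑ k, x k : ℕ) : ℤ) := by
    push_cast
    linarith
  exact_mod_cast h3

/-- `PF(x)`, the finite set of `x`-parking functions. -/
noncomputable def vectorPF {n : ℕ} (x : Fin n → ℕ) : Finset (Fin n → ℕ) :=
  (finite_setOf_isVectorParkingFunction x).toFinset

/-- The reversed sum `(∑_{i=1}^{n} (n + 1 - i) xᵢ) - n - ∑_{i=1}^{n} αᵢ`, an integer. -/
def rsum {n : ℕ} (x α : Fin n → ℕ) : ℤ :=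
  (∑ i : Fin n, ((n : ℤ) + 1 - ((i : ℤ) + 1)) * (x i : ℤ)) - (n : ℤ) - ∑ i : Fin n, (α i : ℤ)

/-- `α` is a (classical) parking function of length `n`: its weakly increasing rearrangement
satisfies `α_{i_j} ≤ j - 1` for all `1 ≤ j ≤ n`. -/
def IsParkingFunction {n : ℕ} (α : Fin n → ℕ) : Prop :=
  ∀ j : Fin n, α (Tuple.sort α j) ≤ (j : ℕ)

theorem finite_setOf_isParkingFunction (n : ℕ) :
    {α : Fin n → ℕ | IsParkingFunction α}.Finite := by
  refine (Set.finite_Iic (fun _ : Fin n => n)).subset ?_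
  intro α hα i
  have h := hα ((Tuple.sort α).symm i)
  rw [Equiv.apply_symm_apply] at h
  exact h.trans (Fin.is_lt _).le

/-- `PF(n)`, the finite set of classical parking functions of length `n`. -/
noncomputable def classicalPF (n : ℕ) : Finset (Fin n → ℕ) :=
  (finite_setOf_isParkingFunction n).toFinset

/-- The reversed sum `binom(n, 2) - ∑ αᵢ` of a classical parking function. -/
def classicalRsum {n : ℕ} (α : Fin n → ℕ) : ℤ :=
  (n.choose 2 : ℤ) - ∑ i : Fin n, (α i : ℤ)

/-! ### Trees on `{0, …, n}` rooted at `0` -/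

/-- Labeled trees with vertex set `{0, …, n}`, always rooted at `0`. -/
abbrev LabeledTree (n : ℕ) : Type :=
  {G : SimpleGraph (Fin (n + 1)) // G.IsTree}

noncomputable instance (n : ℕ) : Fintype (LabeledTree n) := Fintype.ofFinite _

namespace LabeledTree

variable {n : ℕ}

/-- The unique path in `T` from `j` to the root. -/
noncomputable def pathToRoot (T : LabeledTree n) (j : Fin (n + 1)) : T.1.Walk j 0 :=
  (T.2.existsUnique_path j 0).choose

theorem isPath_pathToRoot (T : LabeledTree n) (j : Fin (n + 1)) : (T.pathToRoot j).IsPath :=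
  (T.2.existsUnique_path j 0).choose_spec.1

/-- The tree order: `i ≤_T j` iff the unique path from `j` to the root passes through `i`. -/
def TreeLE (T : LabeledTree n) (i j : Fin (n + 1)) : Prop :=
  i ∈ (T.pathToRoot j).support

/-- The parent of a non-root vertex `j`: the vertex after `j` on the path from `j` to the root.
(It is only used for `j ≠ 0`.) -/
noncomputable def par (T : LabeledTree n) (j : Fin (n + 1)) : Fin (n + 1) :=
  (T.pathToRoot j).snd

theorem treeLE_par (T : LabeledTree n) (j : Fin (n + 1)) : T.TreeLE (T.par j) j :=
  (T.pathToRoot j).getVert_mem_support 1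

theorem par_ne (T : LabeledTree n) {j : Fin (n + 1)} (hj : j ≠ 0) : T.par j ≠ j :=
  ((T.pathToRoot j).adj_snd (SimpleGraph.Walk.not_nil_of_ne hj)).ne'

open Classical in
/-- The number of children of `i`. -/
noncomputable def outdeg (T : LabeledTree n) (i : Fin (n + 1)) : ℕ :=
  (Finset.univ.filter fun j : Fin n => T.par j.succ = i).card

open Classical in
/-- The inversion number of a labeled tree: the number of pairs `(i, j)` with `1 ≤ i < j ≤ n`
such that the path from `i` to `0` passes through `j`. -/
noncomputable def inv (T : LabeledTree n) : ℕ :=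
  (Finset.univ.filter fun p : Fin n × Fin n => p.1 < p.2 ∧ T.TreeLE p.2.succ p.1.succ).card

open Classical in
/-- The inversions of `T` with respect to a relation `r` (written `≺`) on the non-root vertices:
the pairs `(i, j)` of non-root vertices with `i ≤_T j` and `j ≺ i`. The element `i` of `Fin n`
stands for the non-root vertex `i.succ`. -/
noncomputable def inversions (T : LabeledTree n) (r : Fin n → Fin n → Prop) :
    Finset (Fin n × Fin n) :=
  Finset.univ.filter fun p : Fin n × Fin n => T.TreeLE p.1.succ p.2.succ ∧ r p.2 p.1

/-- The conditions for `T` to be a rooted plane tree with its vertices labeled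
`0, 1, …, n` in depth-first (preorder) order. -/
def IsPlane (T : LabeledTree n) : Prop :=
  (∀ i j : Fin n, T.TreeLE i.succ j.succ → i ≤ j) ∧
  (∀ i j k : Fin n, i < j → j < k → T.TreeLE i.succ k.succ → T.TreeLE i.succ j.succ)

/-- `r` (written `≺`) is an admissible vertex order of `T`: a strict total order on the non-root
vertices for which `j ≺ i` whenever `i < j` are siblings. -/
def IsAdmissible (T : LabeledTree n) (r : Fin n → Fin n → Prop) : Prop :=
  IsStrictTotalOrder (Fin n) r ∧
  ∀ i j : Fin n, i < j → T.par i.succ = T.par j.succ → r j i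

end LabeledTree

/-- `RPT(n + 1)`, the rooted plane trees on `n + 1` vertices. -/
abbrev RPT (n : ℕ) : Type := {T : LabeledTree n // T.IsPlane}

noncomputable instance (n : ℕ) : Fintype (RPT n) := Fintype.ofFinite _

/-- `AVO(T)`, the admissible vertex orders of `T`. -/
abbrev AVO {n : ℕ} (T : LabeledTree n) : Type :=
  {r : Fin n → Fin n → Prop // T.IsAdmissible r}

noncomputable instance {n : ℕ} (T : LabeledTree n) : Fintype (AVO T) := Fintype.ofFinite _

theorem RPT.par_lt {n : ℕ} (T : RPT n) (i : Fin n) : (T.1.par i.succ : ℕ) < n := by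
  rcases Fin.eq_zero_or_eq_succ (T.1.par i.succ) with h | ⟨j, hj⟩
  · rw [h]
    exact i.pos
  · have h1 := T.1.treeLE_par i.succ
    have h2 := T.1.par_ne (Fin.succ_ne_zero i)
    rw [hj] at h1 h2 ⊢
    have h3 : j ≤ i := T.2.1 j i h1
    have h4 : j ≠ i := fun h => h2 (by rw [h])
    have h5 : j < i := lt_of_le_of_ne h3 h4
    rw [Fin.lt_def] at h5
    have := i.is_lt
    simp only [Fin.val_succ]
    omega

/-- The entry `x_{par_T(i) + 1}` of `x`, for a non-root vertex `i` of a rooted plane tree `T`. -/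
noncomputable def parEntry {n : ℕ} (x : Fin n → ℕ) (T : RPT n) (i : Fin n) : ℕ :=
  x ⟨(T.1.par i.succ : ℕ), T.par_lt i⟩

/-- The `q`-number `[k]_q = 1 + q + ⋯ + q^(k-1)`. -/
noncomputable def qNumber (k : ℕ) : LaurentPolynomial ℤ :=
  ∑ i ∈ Finset.range k, LaurentPolynomial.T (i : ℤ)

end VectorParking

open VectorParking

/-! All the sums are carried to one set, that of depth-first sequences `(P, σ)`. Vertices are
numbered in order of visit, `P k` is the number of the parent of vertex `k + 1`, and `σ k` is the
label of that vertex. `IsDFS` makes each pair `(P k, σ k)` lexicographically smaller than all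
earlier pairs chosen once vertex `P k` was present.

A plane tree with an admissible order is such a sequence: the tree gives `P` and the ranks in the
order give `σ` (`DFSSeq.bijective_tree_order`). A labeled tree is one as well, through the search
that prefers large labels (`DFSSeq.labeledTree_injective`, `DFSSeq.labeledTree_surjective`), and
inversions correspond.

For a parking function `α`, give each vertex `v` a block of length `x v`. At step `k`, for a label
`l`, line up the blocks of the pending vertices in increasing order; the number `∑_{v ≤ k} x v - 1 -
α l` is a position in this row. For the label `σ k` this position falls in the block of `P k`, at
offset `s k < x (P k)`; this is `IsCode`. Thus `α` corresponds to a unique triple `(P, σ, s)`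
(`IsVectorParkingFunction.exists_isCode`, `IsCode.ext`, `exists_isCode`). Summed over `k`, the
offsets produce the product of `q`-numbers, and the blocks before `P k` produce the inversion
exponent (`sum_inversions_eq`). -/

namespace VectorParking

/-! ### Labeled trees as parent functions -/

namespace LabeledTree

variable {n : ℕ}

theorem eq_pathToRoot (T : LabeledTree n) {j : Fin (n + 1)} {w : T.1.Walk j 0} (hw : w.IsPath) :
    w = T.pathToRoot j :=
  (T.2.existsUnique_path j 0).unique hw (T.isPath_pathToRoot j)

theorem adj_par (T : LabeledTree n) {j : Fin (n + 1)} (hj : j ≠ 0) : T.1.Adj j (T.par j) :=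
  (T.pathToRoot j).adj_snd (SimpleGraph.Walk.not_nil_of_ne hj)

theorem pathToRoot_eq_cons (T : LabeledTree n) {j : Fin (n + 1)} (hj : j ≠ 0) :
    T.pathToRoot j = SimpleGraph.Walk.cons (T.adj_par hj) (T.pathToRoot (T.par j)) := by
  have hnil : ¬ (T.pathToRoot j).Nil := SimpleGraph.Walk.not_nil_of_ne hj
  have h : (T.pathToRoot j).tail = T.pathToRoot (T.par j) :=
    T.eq_pathToRoot (T.isPath_pathToRoot j).tail
  rw [← h]
  exact (SimpleGraph.Walk.cons_tail_eq _ hnil).symm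

theorem pathToRoot_zero (T : LabeledTree n) : T.pathToRoot 0 = SimpleGraph.Walk.nil :=
  (T.eq_pathToRoot SimpleGraph.Walk.IsPath.nil).symm

theorem treeLE_zero_right (T : LabeledTree n) (i : Fin (n + 1)) : T.TreeLE i 0 ↔ i = 0 := by
  simp [TreeLE, pathToRoot_zero]

theorem treeLE_iff (T : LabeledTree n) (i : Fin (n + 1)) {j : Fin (n + 1)} (hj : j ≠ 0) :
    T.TreeLE i j ↔ i = j ∨ T.TreeLE i (T.par j) := by
  simp only [TreeLE]
  rw [T.pathToRoot_eq_cons hj]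
  simp

theorem zero_treeLE (T : LabeledTree n) (j : Fin (n + 1)) : T.TreeLE 0 j :=
  SimpleGraph.Walk.end_mem_support _

/-- The distance of a vertex from the root. -/
noncomputable def depth (T : LabeledTree n) (j : Fin (n + 1)) : ℕ := (T.pathToRoot j).length

theorem depth_par (T : LabeledTree n) {j : Fin (n + 1)} (hj : j ≠ 0) :
    T.depth j = T.depth (T.par j) + 1 := by
  simp only [depth]
  rw [T.pathToRoot_eq_cons hj]
  simp

theorem depth_lt_of_treeLE (T : LabeledTree n) {i j : Fin (n + 1)} (h : T.TreeLE i j)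
    (hij : i ≠ j) : T.depth i < T.depth j := by
  induction hd : T.depth j using Nat.strong_induction_on generalizing j with
  | _ d ih =>
    have hj : j ≠ 0 := by
      rintro rfl
      exact hij ((T.treeLE_zero_right i).1 h)
    have hp := T.depth_par hj
    rcases (T.treeLE_iff i hj).1 h with h | h
    · exact absurd h hij
    · by_cases hip : i = T.par j
      · rw [hip]; omega
      · have := ih _ (by omega) h hip rfl
        omega

theorem par_eq_of_adj_of_not_treeLE (T : LabeledTree n) {a b : Fin (n + 1)} (h : T.1.Adj a b)
    (hab : ¬ T.TreeLE a b) : T.par a = b := by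
  have hp : (SimpleGraph.Walk.cons h (T.pathToRoot b)).IsPath :=
    (T.isPath_pathToRoot b).cons hab
  rw [par, ← T.eq_pathToRoot hp]
  simp

/-- By depth, adjacent vertices cannot each lie on the other's path to the root. If `a` is not on
the path of `b`, prepending `a` gives the path of `a`, so `b` is its parent. -/
theorem adj_iff_par (T : LabeledTree n) (a b : Fin (n + 1)) :
    T.1.Adj a b ↔ (a ≠ 0 ∧ T.par a = b) ∨ (b ≠ 0 ∧ T.par b = a) := by
  constructor
  · intro h
    by_cases hab : T.TreeLE a b
    · have hba : ¬ T.TreeLE b a := fun hba =>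
        lt_asymm (T.depth_lt_of_treeLE hab h.ne) (T.depth_lt_of_treeLE hba h.ne')
      refine Or.inr ⟨?_, T.par_eq_of_adj_of_not_treeLE h.symm hba⟩
      rintro rfl
      exact hba (T.zero_treeLE a)
    · refine Or.inl ⟨?_, T.par_eq_of_adj_of_not_treeLE h hab⟩
      rintro rfl
      exact hab (T.zero_treeLE b)
  · rintro (⟨h, rfl⟩ | ⟨h, rfl⟩)
    · exact T.adj_par h
    · exact (T.adj_par h).symm

theorem ext_par {T T' : LabeledTree n} (h : ∀ k : Fin n, T.par k.succ = T'.par k.succ) :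
    T = T' := by
  have h' : ∀ a, a ≠ 0 → T.par a = T'.par a := by
    intro a ha
    obtain ⟨k, rfl⟩ := Fin.exists_succ_eq.2 ha
    exact h k
  apply Subtype.ext
  ext a b
  rw [adj_iff_par, adj_iff_par]
  constructor
  · rintro (⟨h1, h2⟩ | ⟨h1, h2⟩)
    · exact Or.inl ⟨h1, by rw [← h' a h1, h2]⟩
    · exact Or.inr ⟨h1, by rw [← h' b h1, h2]⟩
  · rintro (⟨h1, h2⟩ | ⟨h1, h2⟩)
    · exact Or.inl ⟨h1, by rw [h' a h1, h2]⟩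
    · exact Or.inr ⟨h1, by rw [h' b h1, h2]⟩

/-- A parent function that decreases some rank comes from a labeled tree. -/
theorem exists_par_eq (q : Fin n → Fin (n + 1)) (ρ : Fin (n + 1) → ℕ)
    (hρ : ∀ k, ρ (q k) < ρ k.succ) : ∃ T : LabeledTree n, ∀ k : Fin n, T.par k.succ = q k := by
  let G : SimpleGraph (Fin (n + 1)) :=
    SimpleGraph.fromEdgeSet (Set.range fun k : Fin n => s(k.succ, q k))
  have hadj : ∀ k : Fin n, G.Adj k.succ (q k) := fun k => by
    simp only [G, SimpleGraph.fromEdgeSet_adj]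
    refine ⟨⟨k, rfl⟩, fun h => ?_⟩
    have := hρ k
    rw [← h] at this
    omega
  have hreach : ∀ d : ℕ, ∀ a, ρ a = d → G.Reachable a 0 := by
    intro d
    induction d using Nat.strong_induction_on with
    | _ d ih =>
      intro a ha
      rcases Fin.eq_zero_or_eq_succ a with rfl | ⟨k, rfl⟩
      · exact SimpleGraph.Reachable.refl _
      · exact (hadj k).reachable.trans (ih _ (ha ▸ hρ k) _ rfl)
  have hconn : G.Connected :=
    { preconnected := fun a b => (hreach _ a rfl).trans (hreach _ b rfl).symm
      nonempty := ⟨0⟩ }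
  -- A connected graph on `n + 1` vertices with at most `n` edges is a tree.
  have hcard : Nat.card G.edgeSet ≤ n := by
    have h1 : G.edgeSet ⊆ Set.range fun k : Fin n => s(k.succ, q k) := by
      simp [G, SimpleGraph.edgeSet_fromEdgeSet]
    calc Nat.card G.edgeSet = G.edgeSet.ncard := rfl
      _ ≤ (Set.range fun k : Fin n => s(k.succ, q k)).ncard :=
        Set.ncard_le_ncard h1 (Set.finite_range _)
      _ ≤ n := by
        rw [← Set.image_univ]
        exact (Set.ncard_image_le Set.finite_univ).trans (by simp)
  have hle := hconn.card_vert_le_card_edgeSet_add_one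
  have hT : G.IsTree := by
    rw [SimpleGraph.isTree_iff_connected_and_card]
    refine ⟨hconn, ?_⟩
    simp only [Nat.card_eq_fintype_card, Fintype.card_fin] at hle hcard ⊢
    omega
  refine ⟨⟨G, hT⟩, ?_⟩
  have hpar : ∀ d : ℕ, ∀ k : Fin n, ρ k.succ = d → par ⟨G, hT⟩ k.succ = q k := by
    intro d
    induction d using Nat.strong_induction_on with
    | _ d ih =>
      intro k hk
      rcases (adj_iff_par ⟨G, hT⟩ _ _).1 (hadj k) with ⟨-, h⟩ | ⟨h0, h⟩
      · exact h
      -- Here `q k = k'.succ` has parent `k.succ`, so by induction `q k' = k.succ`; the ranks of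
      -- `k.succ` and `k'.succ` would each be below the other.
      · exfalso
        obtain ⟨k', hk'⟩ := Fin.exists_succ_eq.2 h0
        have h1 := hρ k
        rw [← hk'] at h h1
        rw [ih _ (hk ▸ h1) k' rfl] at h
        have h2 := hρ k'
        rw [h] at h2
        omega
  exact fun k => hpar _ k rfl

end LabeledTree

/-! ### Strict total orders and permutations -/

theorem exists_equiv_fin_of_isStrictTotalOrder {α : Type*} [Fintype α] (r : α → α → Prop)
    (hr : IsStrictTotalOrder α r) {n : ℕ} (hn : Fintype.card α = n) :
    ∃ σ : α ≃ Fin n, ∀ i j, σ i < σ j ↔ r i j := by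
  classical
  let _ : LinearOrder α := linearOrderOfSTO r
  let e := Fintype.orderIsoFinOfCardEq α hn
  exact ⟨e.symm.toEquiv, fun i j => e.symm.lt_iff_lt⟩

/-- The composite `τ ∘ σ⁻¹` is an order automorphism of `Fin n`, and the identity is the only one.
-/
theorem perm_eq_of_lt_iff {n : ℕ} {σ τ : Equiv.Perm (Fin n)}
    (h : ∀ i j, σ i < σ j ↔ τ i < τ j) : σ = τ := by
  let e : Fin n ≃o Fin n := StrictMono.orderIsoOfSurjective (fun i => τ (σ.symm i))
    (fun i j hij => (h _ _).1 (by simpa using hij)) (τ.surjective.comp σ.symm.surjective)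
  have he : e = OrderIso.refl _ := Subsingleton.elim _ _
  ext i
  have h1 : e (σ i) = σ i := by rw [he]; rfl
  have h2 : e (σ i) = τ i := congrArg τ (σ.symm_apply_apply i)
  rw [← h1, h2]

theorem exists_eq_apply_of_wellFoundedLT {ι β : Type*} [LT ι] [WellFoundedLT ι] [Nonempty β]
    (F : ι → (ι → β) → β) (hF : ∀ k f g, (∀ u < k, f u = g u) → F k f = F k g) :
    ∃ f : ι → β, ∀ k, f k = F k f := by
  classical
  let G : ∀ k : ι, (∀ u, u < k → β) → β := fun k rec =>
    -- The default value is harmless: by `hF`, `F k` depends only on values below `k`.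
    F k fun u => if h : u < k then rec u h else Classical.arbitrary β
  refine ⟨(wellFounded_lt (α := ι)).fix G, fun k => ?_⟩
  rw [WellFounded.fix_eq]
  exact hF _ _ _ fun u hu => by simp [hu]

/-! ### Depth-first sequences -/

variable {n : ℕ}

/-- `P k` is the parent of the vertex `k + 1` and `σ k` its label, for a tree whose vertices are
numbered in the order of a depth-first search that visits children by decreasing label. -/
def IsDFS (P σ : Fin n → Fin n) : Prop :=
  (∀ k, P k ≤ k) ∧
  ∀ u k, u < k → P k ≤ u → toLex (P k, σ k) < toLex (P u, σ u)

/-- Depth-first sequences with pairwise distinct labels. -/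
abbrev DFSSeq (n : ℕ) : Type :=
  {a : (Fin n → Fin n) × Equiv.Perm (Fin n) // IsDFS a.1 a.2}

noncomputable instance (n : ℕ) : Fintype (DFSSeq n) := Fintype.ofFinite _

/-- The vertices that, after the visit of vertex `k`, are still to examine the label `l`. -/
def pending (P σ : Fin n → Fin n) (k l : Fin n) : Finset (Fin n) :=
  Finset.univ.filter fun v => v ≤ k ∧ ∀ u, u < k → v ≤ u → toLex (v, l) < toLex (P u, σ u)

theorem mem_pending {P σ : Fin n → Fin n} {k l v : Fin n} :
    v ∈ pending P σ k l ↔ v ≤ k ∧ ∀ u, u < k → v ≤ u → toLex (v, l) < toLex (P u, σ u) := by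
  simp [pending]

theorem self_mem_pending (P σ : Fin n → Fin n) (k l : Fin n) : k ∈ pending P σ k l :=
  mem_pending.2 ⟨le_rfl, fun _ h h' => absurd (lt_of_lt_of_le h h') (lt_irrefl _)⟩

theorem IsDFS.mem_pending {P σ : Fin n → Fin n} (h : IsDFS P σ) (k : Fin n) :
    P k ∈ pending P σ k (σ k) :=
  VectorParking.mem_pending.2 ⟨h.1 k, fun u hu hp => h.2 u k hu hp⟩

theorem toLex_lt_iff {a b c d : Fin n} :
    toLex (a, b) < toLex (c, d) ↔ a < c ∨ a = c ∧ b < d := Prod.Lex.toLex_lt_toLex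

theorem toLex_le_iff {a b c d : Fin n} :
    toLex (a, b) ≤ toLex (c, d) ↔ a < c ∨ a = c ∧ b ≤ d := Prod.Lex.toLex_le_toLex

theorem IsDFS.parent_le {P σ : Fin n → Fin n} (h : IsDFS P σ) {u k : Fin n} (hu : u < k)
    (hp : P k ≤ u) : P k ≤ P u := by
  rcases toLex_lt_iff.1 (h.2 u k hu hp) with h | h
  · exact h.le
  · exact h.1.le

/-- The ancestor relation, in terms of the parents in a depth-first sequence. -/
theorem treeLE_iff_of_isDFS {P σ : Fin n → Fin n} (h : IsDFS P σ) (T : LabeledTree n)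
    (hT : ∀ k, T.par k.succ = (P k).castSucc) (i j : Fin n) :
    T.TreeLE i.succ j.succ ↔ i ≤ j ∧ ∀ u, i < u → u ≤ j → i < P u := by
  induction hd : (j : ℕ) using Nat.strong_induction_on generalizing j with
  | _ d ih =>
    subst hd
    rw [T.treeLE_iff _ (Fin.succ_ne_zero j), hT, Fin.succ_inj]
    rcases Fin.eq_zero_or_eq_succ (P j).castSucc with h0 | ⟨m, hm⟩
    · rw [h0, T.treeLE_zero_right]
      have hP : (P j : ℕ) = 0 := by simpa using congrArg Fin.val h0
      constructor
      · rintro (rfl | h1)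
        · exact ⟨le_rfl, fun u h1 h2 => absurd (lt_of_lt_of_le h1 h2) (lt_irrefl _)⟩
        · exact absurd h1 (Fin.succ_ne_zero i)
      · rintro ⟨h1, h2⟩
        rcases h1.eq_or_lt with h1 | h1
        · exact Or.inl h1
        · have := h2 j h1 le_rfl
          rw [Fin.lt_def] at this
          omega
    -- The parent is the vertex `m.succ`, numbered `P j = m + 1`, so `i ≤ m` amounts to `i < P j`.
    · have hP : (P j : ℕ) = m + 1 := by simpa using congrArg Fin.val hm
      have hPj : (P j : ℕ) ≤ j := h.1 j
      rw [hm, ih m (by omega) m rfl]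
      constructor
      · rintro (rfl | ⟨h1, h2⟩)
        · exact ⟨le_rfl, fun u h1 h2 => absurd (lt_of_lt_of_le h1 h2) (lt_irrefl _)⟩
        · rw [Fin.le_def] at h1
          have hij : i < P j := by rw [Fin.lt_def]; omega
          refine ⟨by rw [Fin.le_def]; omega, fun u h3 h4 => ?_⟩
          rcases h4.eq_or_lt with rfl | h4
          · exact hij
          · by_cases hu : u ≤ m
            · exact h2 u h3 hu
            · exact lt_of_lt_of_le hij (h.parent_le h4 (by rw [Fin.le_def] at hu ⊢; omega))
      · rintro ⟨h1, h2⟩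
        rcases h1.eq_or_lt with h1 | h1
        · exact Or.inl h1
        · have h3 := h2 j h1 le_rfl
          refine Or.inr ⟨?_, fun u h4 h5 => h2 u h4 ?_⟩
          · rw [Fin.lt_def] at h3; rw [Fin.le_def]; omega
          · rw [Fin.le_def] at h5 ⊢; omega

theorem treeLE_par_of_treeLE (T : LabeledTree n) {i j : Fin n} (h : T.TreeLE i.succ j.succ)
    (hij : i ≠ j) : T.TreeLE i.succ (T.par j.succ) := by
  rcases (T.treeLE_iff _ (Fin.succ_ne_zero j)).1 h with h | h
  · exact absurd (Fin.succ_injective _ h) hij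
  · exact h

/-! ### Plane trees with admissible orders as depth-first sequences -/

/-- The parent function of a rooted plane tree. -/
noncomputable def RPT.parent (T : RPT n) (i : Fin n) : Fin n := ⟨T.1.par i.succ, T.par_lt i⟩

theorem RPT.par_succ (T : RPT n) (i : Fin n) : T.1.par i.succ = (T.parent i).castSucc := rfl

theorem RPT.parent_le (T : RPT n) (i : Fin n) : T.parent i ≤ i := by
  rcases Fin.eq_zero_or_eq_succ (T.1.par i.succ) with h | ⟨m, hm⟩
  · rw [Fin.le_def]
    simp [RPT.parent, h]
  · have h1 := T.2.1 m i (hm ▸ T.1.treeLE_par i.succ)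
    have h2 : m ≠ i := by
      rintro rfl
      exact T.1.par_ne (Fin.succ_ne_zero _) hm
    have h3 := lt_of_le_of_ne h1 h2
    rw [Fin.lt_def] at h3
    rw [Fin.le_def]
    simp only [RPT.parent, hm, Fin.val_succ]
    omega

theorem RPT.parent_le_parent (T : RPT n) {u k : Fin n} (hu : u < k) (hp : T.parent k ≤ u) :
    T.parent k ≤ T.parent u := by
  rcases Fin.eq_zero_or_eq_succ (T.1.par k.succ) with h | ⟨m, hm⟩
  · rw [Fin.le_def]
    simp [RPT.parent, h]
  · have hmu : m < u := by
      rw [Fin.le_def] at hp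
      simp only [RPT.parent, hm, Fin.val_succ] at hp
      rw [Fin.lt_def]; omega
    have h1 := T.2.2 m u k hmu hu (hm ▸ T.1.treeLE_par k.succ)
    have h2 := treeLE_par_of_treeLE T.1 h1 hmu.ne
    rcases Fin.eq_zero_or_eq_succ (T.1.par u.succ) with h | ⟨m', hm'⟩
    · rw [h, T.1.treeLE_zero_right] at h2
      exact absurd h2 (Fin.succ_ne_zero _)
    · rw [hm'] at h2
      have h3 := T.2.1 m m' h2
      rw [Fin.le_def] at h3 ⊢
      simp only [RPT.parent, hm, hm', Fin.val_succ]
      omega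

theorem isDFS_of_isAdmissible (T : RPT n) {r : Fin n → Fin n → Prop} (hr : T.1.IsAdmissible r)
    {σ : Equiv.Perm (Fin n)} (hσ : ∀ i j, σ i < σ j ↔ r i j) : IsDFS T.parent σ := by
  refine ⟨T.parent_le, fun u k hu hp => ?_⟩
  rw [toLex_lt_iff]
  rcases (T.parent_le_parent hu hp).lt_or_eq with h | h
  · exact Or.inl h
  · exact Or.inr ⟨h, (hσ _ _).2 (hr.2 u k hu (by rw [T.par_succ, T.par_succ, h]))⟩

theorem exists_labeledTree_of_isDFS {P σ : Fin n → Fin n} (h : IsDFS P σ) :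
    ∃ T : RPT n, ∀ k, T.1.par k.succ = (P k).castSucc := by
  obtain ⟨T, hT⟩ := LabeledTree.exists_par_eq (fun k => (P k).castSucc) (fun v => (v : ℕ))
    (fun k => by
      have h1 : (P k : ℕ) ≤ k := h.1 k
      simp only [Fin.val_castSucc, Fin.val_succ]
      omega)
  refine ⟨⟨T, fun i j hij => ((treeLE_iff_of_isDFS h T hT i j).1 hij).1,
    fun i j k hij hjk hik => ?_⟩, hT⟩
  have h1 := ((treeLE_iff_of_isDFS h T hT i k).1 hik).2
  exact (treeLE_iff_of_isDFS h T hT i j).2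
    ⟨hij.le, fun u hu huj => h1 u hu (huj.trans hjk.le)⟩

/-- The rooted plane tree of a depth-first sequence. -/
noncomputable def DFSSeq.tree (a : DFSSeq n) : RPT n :=
  (exists_labeledTree_of_isDFS a.2).choose

theorem DFSSeq.par_tree (a : DFSSeq n) (k : Fin n) :
    a.tree.1.par k.succ = (a.1.1 k).castSucc :=
  (exists_labeledTree_of_isDFS a.2).choose_spec k

theorem DFSSeq.parent_tree (a : DFSSeq n) : a.tree.parent = a.1.1 := by
  funext k
  apply Fin.castSucc_injective
  rw [← RPT.par_succ, a.par_tree]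

/-- The admissible vertex order of a depth-first sequence. -/
noncomputable def DFSSeq.order (a : DFSSeq n) : AVO a.tree.1 :=
  ⟨fun i j => a.1.2 i < a.1.2 j,
    { trichotomous := fun i j h1 h2 =>
        a.1.2.injective (le_antisymm (not_lt.1 h2) (not_lt.1 h1))
      irrefl := fun i => lt_irrefl _
      trans := fun i j k => lt_trans },
    fun i j hij hpar => by
      rw [a.par_tree, a.par_tree, Fin.castSucc_inj] at hpar
      have h := a.2.2 i j hij (hpar ▸ a.2.1 i)
      rw [toLex_lt_iff, hpar] at h
      simpa using h⟩

theorem DFSSeq.bijective_tree_order :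
    Function.Bijective fun a : DFSSeq n => (⟨a.tree, a.order⟩ : Σ T : RPT n, AVO T.1) := by
  constructor
  · intro a b hab
    have h1 := congrArg (fun s : Σ T : RPT n, AVO T.1 => s.1.parent) hab
    have h2 := congrArg (fun s : Σ T : RPT n, AVO T.1 => s.2.1) hab
    simp only [DFSSeq.parent_tree] at h1
    refine Subtype.ext (Prod.ext h1 (perm_eq_of_lt_iff fun i j => ?_))
    exact iff_of_eq (congrFun (congrFun h2 i) j)
  · rintro ⟨T, r, hr⟩
    obtain ⟨σ, hσ⟩ := exists_equiv_fin_of_isStrictTotalOrder r hr.1 (Fintype.card_fin n)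
    refine ⟨⟨(T.parent, σ), isDFS_of_isAdmissible T hr hσ⟩, Sigma.subtype_ext ?_ ?_⟩
    · refine Subtype.ext (LabeledTree.ext_par fun k => ?_)
      rw [DFSSeq.par_tree]
      rfl
    · funext i j
      exact propext (hσ i j)

theorem sum_RPT_AVO {M : Type*} [AddCommMonoid M] (f : (T : RPT n) → AVO T.1 → M) :
    ∑ T : RPT n, ∑ r : AVO T.1, f T r = ∑ a : DFSSeq n, f a.tree a.order := by
  rw [← Fintype.sum_sigma']
  exact (Fintype.sum_bijective _ DFSSeq.bijective_tree_order _ _ fun a => rfl).symm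

/-- Sending a vertex to its parent turns the inversions below a vertex into pending vertices. -/
theorem sum_inversions_eq (a : DFSSeq n) (x : Fin n → ℕ) :
    ∑ p ∈ a.tree.1.inversions a.order.1, (parEntry x a.tree p.1 : ℤ) =
      ∑ k, ∑ v ∈ (pending a.1.1 a.1.2 k (a.1.2 k)).filter (· < a.1.1 k), (x v : ℤ) := by
  classical
  obtain ⟨⟨P, σ⟩, h⟩ := a
  set a : DFSSeq n := ⟨(P, σ), h⟩ with ha
  have hle := treeLE_iff_of_isDFS h a.tree.1 a.par_tree
  have hx : ∀ i, parEntry x a.tree i = x (P i) := fun i =>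
    congrArg x (congrFun a.parent_tree i)
  simp only [hx]
  rw [LabeledTree.inversions, Finset.sum_filter, ← Finset.univ_product_univ,
    Finset.sum_product_right]
  refine Finset.sum_congr rfl fun j _ => ?_
  rw [← Finset.sum_filter]
  have hmem : ∀ i, (a.tree.1.TreeLE i.succ j.succ ∧ a.order.1 j i) ↔
      ((i ≤ j ∧ ∀ u, i < u → u ≤ j → i < P u) ∧ σ j < σ i) := fun i => and_congr (hle i j) Iff.rfl
  refine Finset.sum_bij (fun i _ => P i) ?_ ?_ ?_ fun _ _ => rfl
  · intro i hi
    obtain ⟨⟨h1, h2⟩, h3⟩ := (hmem i).1 (Finset.mem_filter.1 hi).2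
    have hij : i < j := lt_of_le_of_ne h1 (by rintro rfl; exact lt_irrefl _ h3)
    have hPi := h.1 i
    refine Finset.mem_filter.2 ⟨mem_pending.2 ⟨hPi.trans h1, fun u hu hv => ?_⟩,
      hPi.trans_lt (h2 j hij le_rfl)⟩
    rw [toLex_lt_iff]
    -- Before `i`, compare with the pair of `i` and use `σ j < σ i`; at `i` the parents agree; after
    -- `i`, parents lie beyond `i`, hence beyond `P i`.
    rcases lt_trichotomy u i with hui | rfl | hui
    · have h4 := h.2 u i hui hv
      rw [toLex_lt_iff] at h4
      exact h4.imp_right fun h4 => ⟨h4.1, h3.trans h4.2⟩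
    · exact Or.inr ⟨rfl, h3⟩
    · exact Or.inl (hPi.trans_lt (h2 u hui hu.le))
  · intro i hi i' hi' hP
    obtain ⟨⟨h1, h2⟩, -⟩ := (hmem i).1 (Finset.mem_filter.1 hi).2
    obtain ⟨⟨h1', h2'⟩, -⟩ := (hmem i').1 (Finset.mem_filter.1 hi').2
    rcases lt_trichotomy i i' with hii | hii | hii
    · exact absurd ((h2 i' hii h1').trans_le (hP ▸ h.1 i)) (lt_irrefl _)
    · exact hii
    · exact absurd ((h2' i hii h1).trans_le (hP ▸ h.1 i')) (lt_irrefl _)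
  · intro v hv
    obtain ⟨hv, hvj⟩ := Finset.mem_filter.1 hv
    obtain ⟨hvj', hv⟩ := mem_pending.1 hv
    -- The preimage of `v` is the last `i ≤ j` with `P i ≤ v`. Since `v` is still pending after `i`,
    -- this forces `P i = v` and `σ j < σ i`.
    let s : Finset (Fin n) := Finset.univ.filter fun u => u ≤ j ∧ P u ≤ v
    have hs : s.Nonempty := by
      refine ⟨v, Finset.mem_filter.2 ⟨Finset.mem_univ _, hvj', h.1 v⟩⟩
    obtain ⟨i, hi, hmax⟩ := s.exists_max_image id hs
    obtain ⟨-, hij, hPi⟩ := Finset.mem_filter.1 hi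
    have hgt : ∀ u, i < u → u ≤ j → v < P u := fun u hu huj => by
      by_contra hcon
      exact absurd (hmax u (Finset.mem_filter.2 ⟨Finset.mem_univ _, huj, not_lt.1 hcon⟩))
        (not_le.2 hu)
    have hvi : v ≤ i := hmax v (Finset.mem_filter.2 ⟨Finset.mem_univ _, hvj', h.1 v⟩)
    have hij' : i < j := lt_of_le_of_ne hij (by rintro rfl; exact absurd hPi (not_le.2 hvj))
    have h1 := hv i hij' hvi
    rw [toLex_lt_iff] at h1
    rcases h1 with h1 | ⟨h1, h2⟩
    · exact absurd hPi (not_le.2 h1)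
    · refine ⟨i, Finset.mem_filter.2 ⟨Finset.mem_univ _, (hmem i).2 ⟨⟨hij, fun u hu huj => ?_⟩,
        h2⟩⟩, h1.symm⟩
      by_contra hcon
      exact absurd ((h.parent_le hu (not_lt.1 hcon)).trans hPi) (not_le.2 (hgt u hu huj))

/-! ### Greedy choices and pigeonhole -/

/-- A pair of sequences may be chosen greedily, each pair being the largest one that is eligible
given the earlier choices. -/
theorem exists_greedy (C : Fin n → (Fin n → Fin n) → (Fin n → Fin n) → Fin n → Fin n → Prop)
    (hC : ∀ k P σ P' σ', (∀ u < k, P u = P' u) → (∀ u < k, σ u = σ' u) →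
      ∀ v l, C k P σ v l → C k P' σ' v l)
    (hne : ∀ k P σ, ∃ v l, C k P σ v l) :
    ∃ P σ : Fin n → Fin n, ∀ k, C k P σ (P k) (σ k) ∧
      ∀ v l, C k P σ v l → toLex (v, l) ≤ toLex (P k, σ k) := by
  classical
  rcases isEmpty_or_nonempty (Fin n) with hn | hn
  · exact ⟨isEmptyElim, isEmptyElim, isEmptyElim⟩
  let D : Fin n → (Fin n → Fin n ×ₗ Fin n) → Finset (Fin n ×ₗ Fin n) := fun k f =>
    Finset.univ.filter fun y =>
      C k (fun u => (ofLex (f u)).1) (fun u => (ofLex (f u)).2) (ofLex y).1 (ofLex y).2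
  have hD : ∀ k f, (D k f).Nonempty := fun k f => by
    obtain ⟨v, l, h⟩ := hne k (fun u => (ofLex (f u)).1) (fun u => (ofLex (f u)).2)
    exact ⟨toLex (v, l), Finset.mem_filter.2 ⟨Finset.mem_univ _, h⟩⟩
  obtain ⟨f, hf⟩ := exists_eq_apply_of_wellFoundedLT (fun k f => (D k f).max' (hD k f))
    (fun k f g hfg => by
      have : D k f = D k g := Finset.filter_congr fun y _ =>
        ⟨hC k _ _ _ _ (fun u hu => by rw [hfg u hu]) (fun u hu => by rw [hfg u hu]) _ _,
          hC k _ _ _ _ (fun u hu => by rw [hfg u hu]) (fun u hu => by rw [hfg u hu]) _ _⟩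
      simp only [this])
  refine ⟨fun u => (ofLex (f u)).1, fun u => (ofLex (f u)).2, fun k => ⟨?_, fun v l h => ?_⟩⟩
  · have h := (D k f).max'_mem (hD k f)
    rw [← hf k] at h
    exact (Finset.mem_filter.1 h).2
  · have h1 := (D k f).le_max' (toLex (v, l)) (Finset.mem_filter.2 ⟨Finset.mem_univ _, h⟩)
    rw [← hf k] at h1
    exact h1

/-- The `k + 1` values of `τ` up to `k` cannot all be among the at most `k` values of `σ` before
`k`. -/
theorem exists_le_forall_lt_ne (k : Fin n) (σ : Fin n → Fin n) {τ : Fin n → Fin n}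
    (hτ : Function.Injective τ) : ∃ j ≤ k, ∀ u < k, σ u ≠ τ j := by
  classical
  by_contra! h
  have h1 : (Finset.Iic k).image τ ⊆ (Finset.Iio k).image σ := fun l hl => by
    obtain ⟨j, hj, rfl⟩ := Finset.mem_image.1 hl
    obtain ⟨u, hu, hl⟩ := h j (Finset.mem_Iic.1 hj)
    exact Finset.mem_image.2 ⟨u, Finset.mem_Iio.2 hu, hl⟩
  have h2 := (Finset.card_le_card h1).trans Finset.card_image_le
  rw [Finset.card_image_of_injective _ hτ, Fin.card_Iic, Fin.card_Iio] at h2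
  omega

theorem injective_of_forall_lt_ne {σ : Fin n → Fin n} (h : ∀ k, ∀ u < k, σ u ≠ σ k) :
    Function.Injective σ := by
  intro a b hab
  rcases lt_trichotomy a b with h1 | h1 | h1
  · exact absurd hab (h b a h1)
  · exact h1
  · exact absurd hab.symm (h a b h1)

/-! ### Depth-first search of labeled trees -/

/-- The labels of all vertices, the root keeping its label `0`. -/
def vertexLabel (σ : Fin n → Fin n) : Fin (n + 1) → Fin (n + 1) :=
  Fin.cons 0 fun i => (σ i).succ

@[simp] theorem vertexLabel_zero (σ : Fin n → Fin n) : vertexLabel σ 0 = 0 := rfl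

@[simp] theorem vertexLabel_succ (σ : Fin n → Fin n) (i : Fin n) :
    vertexLabel σ i.succ = (σ i).succ := rfl

theorem vertexLabel_injective {σ : Fin n → Fin n} (hσ : Function.Injective σ) :
    Function.Injective (vertexLabel σ) := by
  intro a b hab
  rcases Fin.eq_zero_or_eq_succ a with rfl | ⟨i, rfl⟩ <;>
    rcases Fin.eq_zero_or_eq_succ b with rfl | ⟨j, rfl⟩
  · rfl
  · exact absurd hab (Fin.succ_ne_zero _).symm
  · exact absurd hab (Fin.succ_ne_zero _)
  · simp only [vertexLabel_succ, Fin.succ_inj] at hab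
    rw [hσ hab]

theorem vertexLabel_congr {σ σ' : Fin n → Fin n} {k v : Fin n} (h : ∀ u < k, σ u = σ' u)
    (hv : v ≤ k) : vertexLabel σ v.castSucc = vertexLabel σ' v.castSucc := by
  rcases Fin.eq_zero_or_eq_succ v.castSucc with hm | ⟨m, hm⟩
  · rw [hm]; rfl
  · have hval : (v : ℕ) = m + 1 := by simpa using congrArg Fin.val hm
    have hmk : m < k := by rw [Fin.le_def] at hv; rw [Fin.lt_def]; omega
    rw [hm, vertexLabel_succ, vertexLabel_succ, h m hmk]

theorem exists_labeledTree_of_dfsSeq (a : DFSSeq n) : ∃ T : LabeledTree n, ∀ k,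
    T.par (a.1.2 k).succ = vertexLabel a.1.2 (a.1.1 k).castSucc := by
  obtain ⟨T, hT⟩ := LabeledTree.exists_par_eq
    (fun l => vertexLabel a.1.2 (a.1.1 (a.1.2.symm l)).castSucc)
    -- The rank of a labeled vertex is its visit number, and parents are visited before children.
    (fun v => (vertexLabel a.1.2.symm v : ℕ)) (fun l => by
      have h1 : (a.1.1 (a.1.2.symm l) : ℕ) ≤ a.1.2.symm l := a.2.1 _
      have h2 : ∀ v, vertexLabel a.1.2.symm (vertexLabel a.1.2 v) = v := fun v => by
        rcases Fin.eq_zero_or_eq_succ v with rfl | ⟨i, rfl⟩ <;> simp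
      simp only [h2, vertexLabel_succ, Fin.val_castSucc, Fin.val_succ]
      omega)
  exact ⟨T, fun k => by simp [hT]⟩

/-- The labeled tree of a depth-first sequence. -/
noncomputable def DFSSeq.labeledTree (a : DFSSeq n) : LabeledTree n :=
  (exists_labeledTree_of_dfsSeq a).choose

theorem DFSSeq.par_labeledTree (a : DFSSeq n) (k : Fin n) :
    a.labeledTree.par (a.1.2 k).succ = vertexLabel a.1.2 (a.1.1 k).castSucc :=
  (exists_labeledTree_of_dfsSeq a).choose_spec k

/-- Two depth-first sequences agree if at the first disagreement neither choice is smaller. -/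
theorem DFSSeq.ext_of_not_lt {a b : DFSSeq n} {p : DFSSeq n → Prop} (ha : p a) (hb : p b)
    (H : ∀ a b : DFSSeq n, p a → p b → ∀ k,
      (∀ u < k, a.1.1 u = b.1.1 u) → (∀ u < k, a.1.2 u = b.1.2 u) →
      ¬ toLex (b.1.1 k, b.1.2 k) < toLex (a.1.1 k, a.1.2 k)) : a = b := by
  have h : ∀ k, a.1.1 k = b.1.1 k ∧ a.1.2 k = b.1.2 k := by
    intro k
    induction k using WellFoundedLT.induction with
    | _ k ih =>
      have h1 := H a b ha hb k (fun u hu => (ih u hu).1) (fun u hu => (ih u hu).2)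
      have h2 := H b a hb ha k (fun u hu => (ih u hu).1.symm) (fun u hu => (ih u hu).2.symm)
      exact Prod.ext_iff.1 (toLex.injective (le_antisymm (not_lt.1 h1) (not_lt.1 h2)))
  exact Subtype.ext (Prod.ext (funext fun k => (h k).1) (Equiv.ext fun k => (h k).2))

/-- At a first disagreement `k`, the label placed by `a` has the same parent in `b` but is placed
later there. The search condition for `b` then makes its choice at `k` larger than that of `a`; by
symmetry there is no disagreement. -/
theorem DFSSeq.labeledTree_injective :
    Function.Injective (DFSSeq.labeledTree : DFSSeq n → LabeledTree n) := by
  intro a b hab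
  refine DFSSeq.ext_of_not_lt (p := fun c => c.labeledTree = a.labeledTree) rfl hab.symm ?_
  intro a b ha hb k hP hσ hlt
  have hT : a.labeledTree = b.labeledTree := ha.trans hb.symm
  obtain ⟨j, hj⟩ := b.1.2.surjective (a.1.2 k)
  have h1 := a.par_labeledTree k
  rw [hT, ← hj, b.par_labeledTree, vertexLabel_congr hσ (a.2.1 k)] at h1
  have h2 : b.1.1 j = a.1.1 k :=
    Fin.castSucc_injective _ (vertexLabel_injective b.1.2.injective h1)
  rcases lt_trichotomy j k with hjk | rfl | hjk
  · rw [← hσ j hjk] at hj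
    exact hjk.ne (a.1.2.injective hj)
  · rw [h2, hj] at hlt
    exact lt_irrefl _ hlt
  · have h3 := b.2.2 k j hjk (h2 ▸ a.2.1 k)
    rw [h2, hj] at h3
    exact lt_asymm h3 hlt

/-- Always visit the largest pair of a visited vertex and an unvisited child. A later pair whose
parent was already visited was eligible earlier, hence smaller than the pair then chosen. -/
theorem DFSSeq.labeledTree_surjective :
    Function.Surjective (DFSSeq.labeledTree : DFSSeq n → LabeledTree n) := by
  classical
  intro T
  obtain ⟨P, σ, h⟩ := exists_greedy (n := n)
    (fun k P σ v l => (∀ u < k, σ u ≠ l) ∧ v ≤ k ∧ T.par l.succ = vertexLabel σ v.castSucc)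
    (fun k P σ P' σ' _ hσ v l hv =>
      ⟨fun u hu => hσ u hu ▸ hv.1 u hu, hv.2.1, vertexLabel_congr hσ hv.2.1 ▸ hv.2.2⟩)
    (fun k P σ => by
      let s : Finset (Fin n) := Finset.univ.filter fun l => ∀ u < k, σ u ≠ l
      have hs : s.Nonempty := by
        obtain ⟨l, -, hl⟩ := exists_le_forall_lt_ne k σ Function.injective_id
        exact ⟨l, Finset.mem_filter.2 ⟨Finset.mem_univ _, hl⟩⟩
      -- An unvisited label of least depth has a visited parent.
      obtain ⟨l, hl, hmin⟩ := s.exists_min_image (fun l => T.depth l.succ) hs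
      rcases Fin.eq_zero_or_eq_succ (T.par l.succ) with h0 | ⟨m, hm⟩
      · have : NeZero n := ⟨(k.pos).ne'⟩
        exact ⟨0, l, (Finset.mem_filter.1 hl).2, Fin.zero_le _, by rw [h0]; simp⟩
      · have hms : m ∉ s := fun hms => by
          have h1 := hmin m hms
          have h2 := T.depth_par (Fin.succ_ne_zero l)
          rw [hm] at h2
          omega
        have : ∃ u, u < k ∧ σ u = m := by
          by_contra! hcon
          exact hms (Finset.mem_filter.2 ⟨Finset.mem_univ _, hcon⟩)
        obtain ⟨u, hu, hum⟩ := this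
        rw [Fin.lt_def] at hu
        have hk := k.is_lt
        -- The label `σ u` belongs to vertex number `u + 1`, and `u + 1 ≤ k < n`.
        refine ⟨⟨u + 1, by omega⟩, l, (Finset.mem_filter.1 hl).2, ?_, ?_⟩
        · rw [Fin.le_def]
          exact hu
        · have : (⟨u + 1, by omega⟩ : Fin n).castSucc = u.succ := Fin.ext (by simp)
          rw [this, vertexLabel_succ, hm, hum])
  have hinj := injective_of_forall_lt_ne fun k => (h k).1.1
  let a : DFSSeq n := ⟨(P, Equiv.ofBijective σ (Finite.injective_iff_bijective.1 hinj)),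
    fun k => (h k).1.2.1, fun u k hu hp => by
      refine lt_of_le_of_ne ((h u).2 _ _ ⟨fun w hw => (h k).1.1 w (hw.trans hu), hp,
        (h k).1.2.2⟩) fun heq => ?_
      exact hu.ne' (hinj (Prod.ext_iff.1 (toLex.injective heq)).2)⟩
  refine ⟨a, LabeledTree.ext_par fun l => ?_⟩
  obtain ⟨k, rfl⟩ := a.1.2.surjective l
  rw [a.par_labeledTree]
  exact (h k).1.2.2.symm

theorem DFSSeq.treeLE_labeledTree (a : DFSSeq n) (v w : Fin (n + 1)) :
    a.labeledTree.TreeLE (vertexLabel a.1.2 v) (vertexLabel a.1.2 w) ↔ a.tree.1.TreeLE v w := by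
  have hinj := vertexLabel_injective a.1.2.injective
  induction hd : (w : ℕ) using Nat.strong_induction_on generalizing w with
  | _ d ih =>
    subst hd
    rcases Fin.eq_zero_or_eq_succ w with rfl | ⟨k, rfl⟩
    · rw [LabeledTree.treeLE_zero_right, vertexLabel_zero, LabeledTree.treeLE_zero_right]
      exact hinj.eq_iff (b := 0)
    · have hk : (a.1.1 k : ℕ) ≤ k := a.2.1 k
      have hP := ih _ (by simp only [Fin.val_castSucc, Fin.val_succ]; omega)
        (a.1.1 k).castSucc rfl
      rw [LabeledTree.treeLE_iff _ _ (Fin.succ_ne_zero k), a.par_tree, vertexLabel_succ,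
        LabeledTree.treeLE_iff _ _ (Fin.succ_ne_zero _), a.par_labeledTree,
        ← vertexLabel_succ]
      exact or_congr hinj.eq_iff hP

theorem DFSSeq.inv_labeledTree (a : DFSSeq n) :
    a.labeledTree.inv = (a.tree.1.inversions a.order.1).card := by
  classical
  symm
  refine Finset.card_bij (fun p _ => (a.1.2 p.2, a.1.2 p.1)) ?_ ?_ ?_
  · intro p hp
    obtain ⟨h1, h2⟩ := (Finset.mem_filter.1 hp).2
    refine Finset.mem_filter.2 ⟨Finset.mem_univ _, h2, ?_⟩
    exact (a.treeLE_labeledTree p.1.succ p.2.succ).2 h1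
  · rintro ⟨i, j⟩ - ⟨i', j'⟩ - h
    simp only [Prod.mk.injEq, EmbeddingLike.apply_eq_iff_eq] at h
    rw [h.1, h.2]
  · rintro ⟨i, j⟩ hp
    obtain ⟨h1, h2⟩ := (Finset.mem_filter.1 hp).2
    obtain ⟨i, rfl⟩ := a.1.2.surjective i
    obtain ⟨j, rfl⟩ := a.1.2.surjective j
    exact ⟨(j, i), Finset.mem_filter.2 ⟨Finset.mem_univ _,
      (a.treeLE_labeledTree j.succ i.succ).1 h2, h1⟩, rfl⟩

/-! ### Parking functions and depth-first sequences -/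

theorem isVectorParkingFunction_iff (x α : Fin n → ℕ) :
    IsVectorParkingFunction x α ↔ ∀ j, α (Tuple.sort α j) < ∑ v ∈ Finset.Iic j, x v := by
  refine forall_congr' fun j => ?_
  rw [Int.le_sub_one_iff]
  norm_cast

theorem sum_Iic_mono (x : Fin n → ℕ) {j k : Fin n} (h : j ≤ k) :
    ∑ v ∈ Finset.Iic j, x v ≤ ∑ v ∈ Finset.Iic k, x v :=
  Finset.sum_le_sum_of_subset (Finset.Iic_subset_Iic.2 h)

/-- Among the first `j + 1` labels `σ u`, one occupies a sorted position at or after `j`, so its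
bound dominates the `j`-th smallest value. -/
theorem isVectorParkingFunction_of_perm {x α : Fin n → ℕ} (σ : Equiv.Perm (Fin n))
    (h : ∀ k, α (σ k) < ∑ v ∈ Finset.Iic k, x v) : IsVectorParkingFunction x α := by
  rw [isVectorParkingFunction_iff]
  intro j
  obtain ⟨u, huj, hu⟩ := exists_le_forall_lt_ne j (Tuple.sort α) σ.injective
  obtain ⟨i, hi⟩ := (Tuple.sort α).surjective (σ u)
  have hji : j ≤ i := not_lt.1 fun hij => hu i hij hi
  calc α (Tuple.sort α j) ≤ α (Tuple.sort α i) := Tuple.monotone_sort α hji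
    _ = α (σ u) := by rw [hi]
    _ < _ := h u
    _ ≤ _ := sum_Iic_mono x huj

theorem IsVectorParkingFunction.exists_lt {x α : Fin n → ℕ} (h : IsVectorParkingFunction x α)
    (k : Fin n) (σ : Fin n → Fin n) :
    ∃ l, (∀ u < k, σ u ≠ l) ∧ α l < ∑ v ∈ Finset.Iic k, x v := by
  rw [isVectorParkingFunction_iff] at h
  obtain ⟨j, hj, hne⟩ := exists_le_forall_lt_ne k σ (Tuple.sort α).injective
  exact ⟨_, hne, (h j).trans_le (sum_Iic_mono x hj)⟩

/-- `α` is the parking function of the depth-first sequence `a` and the numbers `s`. -/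
def IsCode (x : Fin n → ℕ) (a : DFSSeq n) (s α : Fin n → ℕ) : Prop :=
  ∀ k, s k < x (a.1.1 k) ∧ α (a.1.2 k) + 1 + s k +
    ∑ v ∈ (pending a.1.1 a.1.2 k (a.1.2 k)).filter (· < a.1.1 k), x v = ∑ v ∈ Finset.Iic k, x v

theorem pending_subset_Iic (P σ : Fin n → Fin n) (k l : Fin n) :
    pending P σ k l ⊆ Finset.Iic k :=
  fun _ hv => Finset.mem_Iic.2 (mem_pending.1 hv).1

theorem pending_congr {P σ P' σ' : Fin n → Fin n} {k : Fin n} (hP : ∀ u < k, P u = P' u)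
    (hσ : ∀ u < k, σ u = σ' u) (l : Fin n) : pending P σ k l = pending P' σ' k l := by
  ext v
  simp only [mem_pending]
  refine and_congr_right fun _ => forall₂_congr fun u hu => ?_
  rw [hP u hu, hσ u hu]

theorem sum_filter_le_eq (A : Finset (Fin n)) (x : Fin n → ℕ) {w : Fin n} (hw : w ∈ A) :
    ∑ v ∈ A.filter (· ≤ w), x v = ∑ v ∈ A.filter (· < w), x v + x w := by
  classical
  have : A.filter (· ≤ w) = insert w (A.filter (· < w)) := by
    ext v
    simp only [Finset.mem_filter, Finset.mem_insert]
    constructor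
    · rintro ⟨h1, h2⟩
      exact h2.eq_or_lt.imp_right fun h => ⟨h1, h⟩
    · rintro (rfl | ⟨h1, h2⟩)
      · exact ⟨hw, le_rfl⟩
      · exact ⟨h1, h2.le⟩
  rw [this, Finset.sum_insert (by simp), add_comm]

theorem exists_isCode (x : Fin n → ℕ) (a : DFSSeq n) {s : Fin n → ℕ}
    (hs : ∀ k, s k < x (a.1.1 k)) : ∃ α, IsCode x a s α := by
  have h : ∀ k, ∃ m, m + 1 + s k + ∑ v ∈ (pending a.1.1 a.1.2 k (a.1.2 k)).filter
      (· < a.1.1 k), x v = ∑ v ∈ Finset.Iic k, x v := by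
    intro k
    have h1 := sum_filter_le_eq _ x (a.2.mem_pending k)
    have h2 : ∑ v ∈ (pending a.1.1 a.1.2 k (a.1.2 k)).filter (· ≤ a.1.1 k), x v ≤
        ∑ v ∈ Finset.Iic k, x v :=
      Finset.sum_le_sum_of_subset ((Finset.filter_subset _ _).trans (pending_subset_Iic _ _ _ _))
    have h3 := hs k
    exact ⟨∑ v ∈ Finset.Iic k, x v - 1 - s k -
      ∑ v ∈ (pending a.1.1 a.1.2 k (a.1.2 k)).filter (· < a.1.1 k), x v, by omega⟩
  choose m hm using h
  exact ⟨fun l => m (a.1.2.symm l), fun k => ⟨hs k, by simpa using hm k⟩⟩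

theorem IsCode.unique {x s α β : Fin n → ℕ} {a : DFSSeq n} (h : IsCode x a s α)
    (h' : IsCode x a s β) : α = β := by
  funext l
  obtain ⟨k, rfl⟩ := a.1.2.surjective l
  have h1 := (h k).2
  have h2 := (h' k).2
  omega

theorem IsCode.isVectorParkingFunction {x s α : Fin n → ℕ} {a : DFSSeq n} (h : IsCode x a s α) :
    IsVectorParkingFunction x α :=
  isVectorParkingFunction_of_perm a.1.2 fun k => by
    have := (h k).2
    omega

/-- The label `l` placed by `a` at `k` is placed by `b` at some `j ≥ k`. A smaller choice by `b` at
`k` discards the old vertices from `a.1.1 k` on from the row of `l`. What remains, with the new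
vertices in `(k, j]`, is too short to contain the position of `l`. -/
theorem IsCode.not_toLex_lt {x s s' α : Fin n → ℕ} {a b : DFSSeq n} (ha : IsCode x a s α)
    (hb : IsCode x b s' α) (k : Fin n) (hP : ∀ u < k, a.1.1 u = b.1.1 u)
    (hσ : ∀ u < k, a.1.2 u = b.1.2 u) :
    ¬ toLex (b.1.1 k, b.1.2 k) < toLex (a.1.1 k, a.1.2 k) := by
  classical
  intro hlt
  obtain ⟨j, hj⟩ := b.1.2.surjective (a.1.2 k)
  have hkj : k ≤ j := by
    by_contra! hjk
    rw [← hσ j hjk] at hj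
    exact hjk.ne (a.1.2.injective hj)
  have h1 := (ha k).2
  obtain ⟨h2, h3⟩ := hb j
  have h4 := sum_filter_le_eq _ x (b.2.mem_pending j)
  rw [hj] at h3 h4
  have hsub : (pending b.1.1 b.1.2 j (a.1.2 k)).filter (· ≤ b.1.1 j) ⊆
      Finset.Ioc k j ∪ (pending a.1.1 a.1.2 k (a.1.2 k)).filter (· < a.1.1 k) := by
    intro w hw
    obtain ⟨hw, hwP⟩ := Finset.mem_filter.1 hw
    obtain ⟨hwj, hw⟩ := mem_pending.1 hw
    rw [Finset.mem_union, Finset.mem_Ioc]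
    by_cases hkw : k < w
    · exact Or.inl ⟨hkw, hwj⟩
    · rw [not_lt] at hkw
      refine Or.inr (Finset.mem_filter.2 ⟨mem_pending.2 ⟨hkw, fun u hu hwu => ?_⟩, ?_⟩)
      · rw [hP u hu, hσ u hu]
        exact hw u (hu.trans_le hkj) hwu
      · have h5 : toLex (w, a.1.2 k) ≤ toLex (b.1.1 k, b.1.2 k) := by
          rcases hkj.eq_or_lt with rfl | hkj
          · rw [toLex_le_iff, hj]
            exact hwP.lt_or_eq.imp_right fun h => ⟨h, le_rfl⟩
          · exact (hw k hkj hkw).le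
        simpa [toLex_lt_iff] using h5.trans_lt hlt
  have h5 := Finset.sum_le_sum_of_subset (f := x) hsub
  have h6 := Finset.sum_union_inter (s₁ := Finset.Ioc k j)
    (s₂ := (pending a.1.1 a.1.2 k (a.1.2 k)).filter (· < a.1.1 k)) (f := x)
  have h7 : ∑ v ∈ Finset.Iic j, x v = ∑ v ∈ Finset.Iic k, x v + ∑ v ∈ Finset.Ioc k j, x v := by
    rw [← Finset.sum_union (Finset.disjoint_left.2 fun v h h' =>
      absurd (Finset.mem_Iic.1 h) (not_le.2 (Finset.mem_Ioc.1 h').1))]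
    refine Finset.sum_congr ?_ fun _ _ => rfl
    ext v
    simp only [Finset.mem_union, Finset.mem_Iic, Finset.mem_Ioc]
    exact ⟨fun h => (le_or_gt v k).imp_right fun h' => ⟨h', h⟩,
      fun h => h.elim (fun h => h.trans hkj) fun h => h.2⟩
  omega

theorem IsCode.ext {x s s' α : Fin n → ℕ} {a b : DFSSeq n} (ha : IsCode x a s α)
    (hb : IsCode x b s' α) : a = b ∧ s = s' := by
  have hab : a = b := DFSSeq.ext_of_not_lt (p := fun c => ∃ s, IsCode x c s α) ⟨s, ha⟩ ⟨s', hb⟩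
    fun c d ⟨_, hc⟩ ⟨_, hd⟩ => hc.not_toLex_lt hd
  subst hab
  refine ⟨rfl, funext fun k => ?_⟩
  have h1 := (ha k).2
  have h2 := (hb k).2
  omega

/-- A bound by a sum over `A` that holds as well for the sum over the elements of `A` before any
element outside `Q` holds for the sum over the elements of `A` in `Q`. -/
theorem le_add_sum_filter {A : Finset (Fin n)} {x : Fin n → ℕ} {Q : Fin n → Prop}
    [DecidablePred Q] {X m : ℕ} (hA : X ≤ m + ∑ v ∈ A, x v)
    (hrej : ∀ v ∈ A, ¬ Q v → X ≤ m + ∑ w ∈ A.filter (· < v), x w) :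
    X ≤ m + ∑ v ∈ A.filter Q, x v := by
  rcases (A.filter fun v => ¬ Q v).eq_empty_or_nonempty with h | h
  · rwa [Finset.filter_true_of_mem fun v hv => by
      by_contra hcon
      exact Finset.notMem_empty v (h ▸ Finset.mem_filter.2 ⟨hv, hcon⟩)]
  · obtain ⟨v, hv, hmin⟩ := Finset.exists_min_image _ id h
    obtain ⟨hvA, hvQ⟩ := Finset.mem_filter.1 hv
    refine (hrej v hvA hvQ).trans (Nat.add_le_add_left (Finset.sum_le_sum_of_subset ?_) m)
    intro w hw
    obtain ⟨hwA, hwv⟩ := Finset.mem_filter.1 hw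
    refine Finset.mem_filter.2 ⟨hwA, ?_⟩
    by_contra hcon
    exact absurd (hmin w (Finset.mem_filter.2 ⟨hwA, hcon⟩)) (not_le.2 hwv)

theorem pending_succ (P σ : Fin n → Fin n) {k k' : Fin n} (hk : (k' : ℕ) = k + 1) (l : Fin n) :
    pending P σ k' l =
      insert k' ((pending P σ k l).filter fun v => toLex (v, l) < toLex (P k, σ k)) := by
  classical
  ext v
  simp only [Finset.mem_insert, Finset.mem_filter, mem_pending, Fin.le_def, Fin.lt_def, Fin.ext_iff]
  constructor
  · rintro ⟨h1, h2⟩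
    rcases h1.eq_or_lt with h1 | h1
    · exact Or.inl h1
    · exact Or.inr ⟨⟨by omega, fun u hu hv => h2 u (by omega) hv⟩, h2 k (by omega) (by omega)⟩
  · rintro (h | ⟨⟨h1, h2⟩, h3⟩)
    · exact ⟨h.le, fun u hu hv => by omega⟩
    · refine ⟨by omega, fun u hu hv => ?_⟩
      by_cases huk : (u : ℕ) = k
      · rwa [Fin.ext huk]
      · exact h2 u (by omega) hv

/-- A pair `(v, l)` is eligible when the position of `l` is not before the block of `v`. Taking the
largest eligible pair makes the position fall inside the chosen block, provided it never runs past
the end of the row. -/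
theorem IsVectorParkingFunction.exists_isCode {x α : Fin n → ℕ}
    (hα : IsVectorParkingFunction x α) : ∃ a s, IsCode x a s α := by
  classical
  obtain ⟨P, σ, h⟩ := exists_greedy (n := n)
    (fun k P σ v l => (∀ u < k, σ u ≠ l) ∧ v ∈ pending P σ k l ∧
      α l + ∑ w ∈ (pending P σ k l).filter (· < v), x w < ∑ w ∈ Finset.Iic k, x w)
    (fun k P σ P' σ' hP hσ v l hv => by
      rw [pending_congr hP hσ] at hv
      exact ⟨fun u hu => hσ u hu ▸ hv.1 u hu, hv.2⟩)
    (fun k P σ => by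
      obtain ⟨l, hl, hlt⟩ := hα.exists_lt k σ
      obtain ⟨v, hv, hmin⟩ := (pending P σ k l).exists_min_image id ⟨k, self_mem_pending P σ k l⟩
      refine ⟨v, l, hl, hv, ?_⟩
      change ∀ w ∈ _, v ≤ w at hmin
      rwa [Finset.filter_false_of_mem fun w hw => not_lt.2 (hmin w hw), Finset.sum_empty,
        add_zero])
  have hrej : ∀ k l, (∀ u < k, σ u ≠ l) → ∀ v ∈ pending P σ k l,
      ¬ toLex (v, l) ≤ toLex (P k, σ k) →
      ∑ w ∈ Finset.Iic k, x w ≤ α l + ∑ w ∈ (pending P σ k l).filter (· < v), x w :=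
    fun k l hl v hv hle => not_lt.1 fun hlt => hle ((h k).2 v l ⟨hl, hv, hlt⟩)
  -- The invariant: the position of an unplaced label lies before the end of its row.
  have hbound : ∀ (m : ℕ) (k : Fin n), (k : ℕ) = m → ∀ l, (∀ u < k, σ u ≠ l) →
      ∑ w ∈ Finset.Iic k, x w ≤ α l + ∑ w ∈ pending P σ k l, x w := by
    intro m
    induction m with
    | zero =>
      intro k hk l _
      refine le_add_left (Finset.sum_le_sum_of_subset fun v hv => ?_)
      have : v = k := by
        have := Finset.mem_Iic.1 hv
        rw [Fin.le_def] at this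
        exact Fin.ext (by omega)
      rw [this]
      exact self_mem_pending _ _ _ _
    | succ m ih =>
      intro k' hk' l hl
      obtain ⟨k, hk⟩ : ∃ k : Fin n, (k : ℕ) = m := ⟨⟨m, by omega⟩, rfl⟩
      have hkk : k < k' := by rw [Fin.lt_def]; omega
      have hl' : ∀ u < k, σ u ≠ l := fun u hu => hl u (hu.trans hkk)
      -- Every vertex leaving the row was ineligible for `l`, so the bound survives its removal; the
      -- new vertex `k'` then adds `x k'` to both sides.
      have h1 := le_add_sum_filter (ih k hk l hl') (hrej k l hl')
      have h2 : Finset.Iic k' = insert k' (Finset.Iic k) := by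
        ext v
        simp only [Finset.mem_Iic, Finset.mem_insert, Fin.le_def, Fin.ext_iff]
        omega
      have h3 : ∀ v, toLex (v, l) ≤ toLex (P k, σ k) ↔ toLex (v, l) < toLex (P k, σ k) := fun v =>
        ⟨fun h => lt_of_le_of_ne h fun heq =>
          hl k hkk (Prod.ext_iff.1 (toLex.injective heq)).2.symm, le_of_lt⟩
      have hk'Iic : k' ∉ Finset.Iic k := fun hmem => absurd (Finset.mem_Iic.1 hmem) (not_le.2 hkk)
      simp only [h3] at h1
      rw [h2, Finset.sum_insert hk'Iic, pending_succ P σ (hk'.trans (congrArg (· + 1) hk.symm)), Finset.sum_insert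
        fun hmem => hk'Iic (pending_subset_Iic _ _ _ _ (Finset.mem_filter.1 hmem).1)]
      omega
  have hinj := injective_of_forall_lt_ne fun k => (h k).1.1
  let a : DFSSeq n := ⟨(P, Equiv.ofBijective σ (Finite.injective_iff_bijective.1 hinj)),
    fun k => (mem_pending.1 (h k).1.2.1).1, fun u k hu hp => (mem_pending.1 (h k).1.2.1).2 u hu hp⟩
  -- The offset of the position in the block of `P k`; eligibility ensures that the subtractions do
  -- not truncate.
  refine ⟨a, fun k => ∑ w ∈ Finset.Iic k, x w - 1 - α (σ k) -
    ∑ v ∈ (pending P σ k (σ k)).filter (· < P k), x v, fun k => ?_⟩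
  change _ < x (P k) ∧ α (σ k) + 1 + _ + ∑ v ∈ (pending P σ k (σ k)).filter (· < P k), x v = _
  obtain ⟨h1, h2, h3⟩ := (h k).1
  have h4 := le_add_sum_filter (hbound k k rfl _ h1) (hrej k _ h1)
  have h5 := sum_filter_le_eq _ x h2
  simp only [toLex_le_iff, le_refl, and_true, ← le_iff_lt_or_eq] at h4
  refine ⟨?_, ?_⟩ <;> dsimp only <;> omega

/-! ### The generating functions -/

theorem sum_sum_Iic (x : Fin n → ℕ) :
    ∑ i : Fin n, ((n : ℤ) + 1 - ((i : ℤ) + 1)) * (x i : ℤ) =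
      ∑ k : Fin n, ∑ v ∈ Finset.Iic k, (x v : ℤ) := by
  -- The coefficient `n - v` counts the `k ≥ v`.
  rw [Finset.sum_comm' (t' := Finset.univ) (s' := fun v => Finset.Ici v) (by simp)]
  refine Finset.sum_congr rfl fun v _ => ?_
  rw [Finset.sum_const, Fin.card_Ici, nsmul_eq_mul, Nat.cast_sub v.is_lt.le]
  ring

theorem IsCode.rsum_eq {x s α : Fin n → ℕ} {a : DFSSeq n} (h : IsCode x a s α) :
    rsum x α = (∑ k, ∑ v ∈ (pending a.1.1 a.1.2 k (a.1.2 k)).filter (· < a.1.1 k), (x v : ℤ)) +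
      ∑ k, (s k : ℤ) := by
  have h1 : ∀ k, (α (a.1.2 k) : ℤ) = ∑ v ∈ Finset.Iic k, (x v : ℤ) - 1 - s k -
      ∑ v ∈ (pending a.1.1 a.1.2 k (a.1.2 k)).filter (· < a.1.1 k), (x v : ℤ) := fun k => by
    have := congrArg (Nat.cast : ℕ → ℤ) (h k).2
    push_cast at this
    linarith
  have h2 : ∑ i, (α i : ℤ) = ∑ k, (α (a.1.2 k) : ℤ) :=
    (Equiv.sum_comp a.1.2 fun i => (α i : ℤ)).symm
  rw [rsum, sum_sum_Iic, h2]
  simp only [h1, Finset.sum_sub_distrib, Finset.sum_const, Finset.card_univ, Fintype.card_fin,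
    nsmul_eq_mul, mul_one]
  ring

theorem mem_vectorPF {x α : Fin n → ℕ} : α ∈ vectorPF x ↔ IsVectorParkingFunction x α := by
  simp [vectorPF]

theorem T_sum {ι : Type*} (s : Finset ι) (f : ι → ℤ) :
    (LaurentPolynomial.T (∑ i ∈ s, f i) : LaurentPolynomial ℤ) =
      ∏ i ∈ s, LaurentPolynomial.T (f i) := by
  classical
  induction s using Finset.induction_on with
  | empty => simp
  | insert a s ha ih => rw [Finset.sum_insert ha, Finset.prod_insert ha, LaurentPolynomial.T_add, ih]

theorem prod_qNumber (y : Fin n → ℕ) :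
    ∏ k, qNumber (y k) = ∑ s ∈ Fintype.piFinset fun k => Finset.range (y k),
      (LaurentPolynomial.T (∑ k, (s k : ℤ)) : LaurentPolynomial ℤ) := by
  simp only [qNumber, Finset.prod_univ_sum, T_sum]

theorem prod_pow_outdeg {M : Type*} [CommMonoid M] (a : DFSSeq n) (f : Fin n → M) :
    ∏ i, f i ^ a.tree.1.outdeg i.castSucc = ∏ k, f (a.1.1 k) := by
  classical
  rw [← Finset.prod_fiberwise Finset.univ a.1.1 fun k => f (a.1.1 k)]
  refine Finset.prod_congr rfl fun i _ => ?_
  have : ∏ k with a.1.1 k = i, f (a.1.1 k) = ∏ k with a.1.1 k = i, f i :=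
    Finset.prod_congr rfl fun k hk => by rw [(Finset.mem_filter.1 hk).2]
  rw [this, Finset.prod_const, LabeledTree.outdeg]
  congr 2
  ext k
  simp only [Finset.mem_filter, a.par_tree, Fin.castSucc_inj]

theorem sum_vectorPF (x : Fin n → ℕ) :
    ∑ α ∈ vectorPF x, (LaurentPolynomial.T (rsum x α) : LaurentPolynomial ℤ) =
      ∑ a : DFSSeq n, LaurentPolynomial.T
        (∑ k, ∑ v ∈ (pending a.1.1 a.1.2 k (a.1.2 k)).filter (· < a.1.1 k), (x v : ℤ)) *
        ∏ k, qNumber (x (a.1.1 k)) := by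
  simp only [prod_qNumber, Finset.mul_sum, ← LaurentPolynomial.T_add]
  rw [Finset.sum_sigma']
  symm
  have hcode : ∀ p ∈ Finset.univ.sigma fun a : DFSSeq n =>
      Fintype.piFinset fun k => Finset.range (x (a.1.1 k)), ∃ α, IsCode x p.1 p.2 α := fun p hp =>
    exists_isCode x p.1 fun k =>
      Finset.mem_range.1 (Fintype.mem_piFinset.1 (Finset.mem_sigma.1 hp).2 k)
  choose! code hcode using hcode
  refine Finset.sum_bij (fun p _ => code p) ?_ ?_ ?_ ?_
  · exact fun p hp => mem_vectorPF.2 (hcode p hp).isVectorParkingFunction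
  · rintro ⟨a, s⟩ hp ⟨b, s'⟩ hq heq
    obtain ⟨rfl, rfl⟩ := (hcode _ hp).ext (heq ▸ hcode _ hq)
    rfl
  · intro α hα
    obtain ⟨a, s, h⟩ := (mem_vectorPF.1 hα).exists_isCode
    have hp : (⟨a, s⟩ : Σ _ : DFSSeq n, Fin n → ℕ) ∈ Finset.univ.sigma fun a : DFSSeq n =>
        Fintype.piFinset fun k => Finset.range (x (a.1.1 k)) :=
      Finset.mem_sigma.2 ⟨Finset.mem_univ _,
        Fintype.mem_piFinset.2 fun k => Finset.mem_range.2 (h k).1⟩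
    exact ⟨_, hp, (hcode _ hp).unique h⟩
  · exact fun p hp => by rw [(hcode p hp).rsum_eq]

theorem sum_vectorPF_eq_sum_RPT (x : Fin n → ℕ) :
    ∑ α ∈ vectorPF x, (LaurentPolynomial.T (rsum x α) : LaurentPolynomial ℤ) =
      ∑ T : RPT n,
        (∑ r : AVO T.1,
          (LaurentPolynomial.T (∑ p ∈ T.1.inversions r.1, (parEntry x T p.1 : ℤ)) :
            LaurentPolynomial ℤ)) *
        ∏ i : Fin n, qNumber (x i) ^ T.1.outdeg i.castSucc := by
  simp only [Finset.sum_mul]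
  rw [sum_RPT_AVO, sum_vectorPF]
  refine Finset.sum_congr rfl fun a _ => ?_
  rw [sum_inversions_eq, prod_pow_outdeg a fun i => qNumber (x i)]

theorem sum_vectorPF_one_eq_sum_classicalPF (n : ℕ) :
    ∑ α ∈ vectorPF (fun _ : Fin n => 1),
        (LaurentPolynomial.T (rsum (fun _ : Fin n => 1) α) : LaurentPolynomial ℤ) =
      ∑ α ∈ classicalPF n, LaurentPolynomial.T (classicalRsum α) := by
  have h1 : vectorPF (fun _ : Fin n => 1) = classicalPF n := by
    ext α
    rw [mem_vectorPF, isVectorParkingFunction_iff]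
    simp [classicalPF, IsParkingFunction]
  have h2 : ∑ i : Fin n, ((n : ℤ) + 1 - ((i : ℤ) + 1)) * ((1 : ℕ) : ℤ) =
      n.choose 2 + n := by
    have h3 : ∑ i : Fin n, ((i : ℕ) : ℤ) = n.choose 2 := by
      rw [Fin.sum_univ_eq_sum_range fun i => (i : ℤ), ← Nat.cast_sum, Finset.sum_range_id,
        Nat.choose_two_right]
    -- Reversing indices turns the coefficient `n - i` into the reversed index plus `1`.
    rw [← h3, ← Equiv.sum_comp Fin.revPerm fun i : Fin n => ((i : ℕ) : ℤ)]
    have h4 : ∀ i : Fin n, ((n : ℤ) + 1 - ((i : ℤ) + 1)) * ((1 : ℕ) : ℤ) =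
        ((Fin.revPerm i : ℕ) : ℤ) + 1 := fun i => by
      have := i.is_lt
      rw [Fin.revPerm_apply, Fin.val_rev]
      push_cast [Nat.cast_sub (show (i : ℕ) + 1 ≤ n from this)]
      ring
    simp only [h4, Finset.sum_add_distrib, Finset.sum_const, Finset.card_univ, Fintype.card_fin,
      nsmul_eq_mul, mul_one]
  rw [h1]
  refine Finset.sum_congr rfl fun α _ => ?_
  rw [rsum, classicalRsum, h2, add_sub_cancel_right]

theorem sum_RPT_one_eq_sum_labeledTree (n : ℕ) :
    ∑ T : RPT n,
        (∑ r : AVO T.1,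
          (LaurentPolynomial.T (∑ p ∈ T.1.inversions r.1,
            (parEntry (fun _ : Fin n => 1) T p.1 : ℤ)) : LaurentPolynomial ℤ)) *
        ∏ i : Fin n, qNumber 1 ^ T.1.outdeg i.castSucc =
      ∑ T : LabeledTree n, LaurentPolynomial.T (T.inv : ℤ) := by
  have h1 : qNumber 1 = 1 := by simp [qNumber]
  simp only [h1, one_pow, Finset.prod_const_one, mul_one]
  rw [sum_RPT_AVO]
  refine Fintype.sum_bijective _ ⟨DFSSeq.labeledTree_injective, DFSSeq.labeledTree_surjective⟩ _ _
    fun a => ?_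
  rw [a.inv_labeledTree]
  simp [parEntry]

end VectorParking

theorem mainTheorem1 (n : ℕ) :
    -- the identity for every vector `x`
    (∀ x : Fin n → ℕ,
      ∑ α ∈ vectorPF x, (LaurentPolynomial.T (rsum x α) : LaurentPolynomial ℤ) =
        ∑ T : RPT n,
          (∑ r : AVO T.1,
            (LaurentPolynomial.T (∑ p ∈ T.1.inversions r.1, (parEntry x T p.1 : ℤ)) :
              LaurentPolynomial ℤ)) *
          ∏ i : Fin n, qNumber (x i) ^ T.1.outdeg i.castSucc) ∧
    -- for `x = (1, …, 1)` the two sides are those of Kreweras's identity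
    (∑ α ∈ vectorPF (fun _ : Fin n => 1),
        (LaurentPolynomial.T (rsum (fun _ : Fin n => 1) α) : LaurentPolynomial ℤ) =
      ∑ α ∈ classicalPF n, LaurentPolynomial.T (classicalRsum α)) ∧
    (∑ T : RPT n,
        (∑ r : AVO T.1,
          (LaurentPolynomial.T (∑ p ∈ T.1.inversions r.1,
            (parEntry (fun _ : Fin n => 1) T p.1 : ℤ)) : LaurentPolynomial ℤ)) *
        ∏ i : Fin n, qNumber 1 ^ T.1.outdeg i.castSucc =
      ∑ T : LabeledTree n, LaurentPolynomial.T (T.inv : ℤ)) ∧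
    -- Kreweras's identity
    (∑ α ∈ classicalPF n, (LaurentPolynomial.T (classicalRsum α) : LaurentPolynomial ℤ) =
      ∑ T : LabeledTree n, LaurentPolynomial.T (T.inv : ℤ)) :=
  ⟨sum_vectorPF_eq_sum_RPT, sum_vectorPF_one_eq_sum_classicalPF n,
    sum_RPT_one_eq_sum_labeledTree n,
    (sum_vectorPF_one_eq_sum_classicalPF n).symm.trans
      ((sum_vectorPF_eq_sum_RPT _).trans (sum_RPT_one_eq_sum_labeledTree n))⟩
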